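/- Let $d,m\ge 0$ be integers and let $\mathbb{T}^m=(\mathbb{R}/2\pi\mathbb{Z})^m$. A matrix-valued function on $\mathbb{T}^m$ is called piecewise smooth if there are countably many pairwise disjoint open pieces, covering $\mathbb{T}^m$ up to a set of measure zero, on each of which it is $C^\infty$. Let $H(t)$, $t\in\mathbb{R}$, be an $m$-time-quasiperiodic Hamiltonian on $\mathbb{C}^d$: $H(t)=\hat H(\boldsymbol\omega t \bmod 2\pi)$ for a piecewise-smooth Hermitian-matrix-valued function $\hat H$ on $\mathbb{T}^m$ and a rationally independent frequency vector $\boldsymbol\omega=(\omega_1,\dots,\omega_m)\in\mathbb{R}^m$ (that is, $\boldsymbol n\cdot\boldsymbol\omega=0$ with $\boldsymbol n\in\mathbb{Z}^m$ only for $\boldsymbol n=\boldsymbol 0$). Suppose that $H$ is integrable over bounded time intervals, and let $U(t)$, $t\ge 0$, be its evolution operator, i.e. the continuous solution of $U(t)=\mathbb{1}-i\int_0^t H(s)U(s)\,ds$. Suppose that $H$ has a basis of piecewise-smooth quasienergy eigenstates, i.e. that there is a generalized Floquet decomposition $$U(t)=P(\boldsymbol\omega t)\,e^{-iQt}\qquad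 (t\ge 0),$$ where $P$ is a piecewise-smooth function from $\mathbb{T}^m$ to the unitary group $\mathrm{U}(d)$ with $P(\boldsymbol 0)=\mathbb{1}$, and $Q$ is a Hermitian $d\times d$ matrix (the quasienergy eigenstates are $\boldsymbol\theta\mapsto P(\boldsymbol\theta)|\alpha\rangle$, with $|\alpha\rangle$ in an orthonormal eigenbasis of $Q$). If $m<d(d-1)$, then the evolution does not exhibit complete unitary ergodicity. Here complete unitary ergodicity means that the temporal ensemble $\{U(t)^*\otimes U(t)\}_{t\ge 0}$ (with $U^*$ the entrywise complex conjugate) has the same distribution as $\{V^*\otimes V\}$ for Haar-random $V\in\mathrm{U}(d)$, that is, for every continuous function $f$ on the projective unitary group $\mathrm{PU}(d)=\{V^*\otimes V: V\in \mathrm{U}(d)\}$, $$\lim_{T\to\infty}\frac1T\int_0^T f\big(U(t)^*\otimes U(t)\big)\,dt=\int_{\mathrm{U}(d)} f(V^*\otimes V)\,dV .$$ -/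

import Mathlib

open MeasureTheory Filter Topology
open scoped Kronecker

/-! ### Tori, windings and piecewise smooth functions -/

instance instFactTwoPiPos : Fact (0 < 2 * Real.pi) := ⟨Real.two_pi_pos⟩

/-- The `m`-dimensional torus `(ℝ / 2πℤ)ᵐ`, with its product topology and product measure. -/
abbrev Torus (m : ℕ) : Type := Fin m → AddCircle (2 * Real.pi)

/-- Reduction modulo `2π` of each coordinate, `ℝᵐ → 𝕋ᵐ`. -/
noncomputable def toTorus {m : ℕ} (x : Fin m → ℝ) : Torus m := fun j => (x j : AddCircle (2 * Real.pi))

/-- The winding `t ↦ ω t mod 2π` with frequency vector `ω`. -/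
noncomputable def winding {m : ℕ} (ω : Fin m → ℝ) (t : ℝ) : Torus m := toTorus (fun j => ω j * t)

/-- The frequencies `ω` are rationally independent: `n ⬝ ω = 0` with `n ∈ ℤᵐ` forces `n = 0`. -/
def RationallyIndependent {m : ℕ} (ω : Fin m → ℝ) : Prop :=
  ∀ n : Fin m → ℤ, ∑ j, (n j : ℝ) * ω j = 0 → n = 0

/-- A matrix-valued function on the torus is piecewise smooth, possibly with countably many pieces:
there are countably many pairwise disjoint open pieces, covering the torus up to a null set (the
boundaries of the pieces), and the function is `C^∞` on each of them. Smoothness is read in the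
coordinates `ℝᵐ → 𝕋ᵐ`. Nothing is asked of the values on the boundaries, and derivatives may blow up
there. -/
def PiecewiseSmooth {m d : ℕ} (f : Torus m → Matrix (Fin d) (Fin d) ℂ) : Prop :=
  ∃ O : ℕ → Set (Torus m),
    (∀ k, IsOpen (O k)) ∧ Pairwise (fun k l => Disjoint (O k) (O l)) ∧
    volume (⋃ k, O k)ᶜ = 0 ∧
    ∀ k, ∀ a b : Fin d,
      ContDiffOn ℝ (⊤ : ℕ∞) (fun x : Fin m → ℝ => f (toTorus x) a b) (toTorus ⁻¹' O k)

/-! ### Quasiperiodic Hamiltonians, evolution operators, generalized Floquet decomposition -/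

/-- `H` is a time-quasiperiodic Hamiltonian with the `m` tones `ω`: the frequencies are rationally
independent and `H(t) = Ĥ(ω t)` for a piecewise smooth parent Hamiltonian `Ĥ` on the torus. -/
def IsQuasiperiodicHamiltonian {m d : ℕ} (ω : Fin m → ℝ)
    (H : ℝ → Matrix (Fin d) (Fin d) ℂ) : Prop :=
  RationallyIndependent ω ∧
  ∃ Hhat : Torus m → Matrix (Fin d) (Fin d) ℂ,
    (∀ θ, (Hhat θ).IsHermitian) ∧ PiecewiseSmooth Hhat ∧ ∀ t : ℝ, H t = Hhat (winding ω t)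

/-- `U` is the evolution operator (time-ordered exponential) generated by `H` from time `0`: `H` is
integrable over bounded time intervals and `U` is the continuous solution of
`U(t) = 1 - i ∫₀ᵗ H(s) U(s) ds` for `t ≥ 0`. -/
structure IsEvolutionOperator {d : ℕ} (H U : ℝ → Matrix (Fin d) (Fin d) ℂ) : Prop where
  integrable : ∀ t : ℝ, 0 ≤ t → ∀ a b : Fin d,
    IntervalIntegrable (fun s => H s a b) volume 0 t
  continuousOn : ContinuousOn U (Set.Ici 0)
  schrodinger : ∀ t : ℝ, 0 ≤ t → ∀ a b : Fin d,
    U t a b = (1 : Matrix (Fin d) (Fin d) ℂ) a b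
      - Complex.I * ∫ s in (0 : ℝ)..t, (H s * U s) a b

/-- The generalized Floquet decomposition `U(t) = P(ω t) e^{-iQt}`, with `P` a piecewise smooth
unitary on the torus, `P(0) = 1`, and `Q` Hermitian. -/
structure IsFloquetDecomposition {m d : ℕ} (ω : Fin m → ℝ) (U : ℝ → Matrix (Fin d) (Fin d) ℂ)
    (P : Torus m → Matrix (Fin d) (Fin d) ℂ) (Q : Matrix (Fin d) (Fin d) ℂ) : Prop where
  unitary : ∀ θ, P θ ∈ Matrix.unitaryGroup (Fin d) ℂ
  piecewiseSmooth : PiecewiseSmooth P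
  map_zero : P 0 = 1
  hermitian : Q.IsHermitian
  decomposition : ∀ t : ℝ, 0 ≤ t →
    U t = P (winding ω t) * NormedSpace.exp ((-(Complex.I * (t : ℂ))) • Q)

/-- The evolution `U` has a basis of piecewise smooth quasienergy eigenstates over the torus with
frequency vector `ω`, that is, it admits a generalized Floquet decomposition. The quasienergy
eigenstates are `θ ↦ P(θ) v`, for `v` in an orthonormal eigenbasis of `Q`, and the quasienergies are
the eigenvalues of `Q`. -/
def HasQuasienergyEigenbasis {m d : ℕ} (ω : Fin m → ℝ)
    (U : ℝ → Matrix (Fin d) (Fin d) ℂ) : Prop :=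
  ∃ (P : Torus m → Matrix (Fin d) (Fin d) ℂ) (Q : Matrix (Fin d) (Fin d) ℂ),
    IsFloquetDecomposition ω U P Q

/-! ### Haar measure on the unitary group -/

noncomputable instance instMeasurableSpaceUnitaryGroup (d : ℕ) :
    MeasurableSpace (Matrix.unitaryGroup (Fin d) ℂ) := borel _

instance instBorelSpaceUnitaryGroup (d : ℕ) :
    BorelSpace (Matrix.unitaryGroup (Fin d) ℂ) := ⟨rfl⟩

instance instCompactSpaceUnitaryGroup (d : ℕ) :
    CompactSpace (Matrix.unitaryGroup (Fin d) ℂ) := by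
  apply isCompact_iff_compactSpace.mp
  have hK : IsCompact (Set.pi Set.univ fun _ : Fin d => Set.pi Set.univ fun _ : Fin d =>
      Metric.closedBall (0 : ℂ) 1) :=
    isCompact_univ_pi fun _ => isCompact_univ_pi fun _ => isCompact_closedBall _ _
  refine hK.of_isClosed_subset ?_ ?_
  · have h : ((Matrix.unitaryGroup (Fin d) ℂ : Submonoid (Matrix (Fin d) (Fin d) ℂ)) :
        Set (Matrix (Fin d) (Fin d) ℂ)) = {A | A * star A = 1} := by
      ext A
      exact Matrix.mem_unitaryGroup_iff
    rw [h]
    exact isClosed_eq (by fun_prop) continuous_const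
  · intro A hA a _ b _
    simpa using entry_norm_bound_of_unitary hA a b

/-- The Haar probability measure on `U(d)`. -/
noncomputable def haarUnitary (d : ℕ) : Measure (Matrix.unitaryGroup (Fin d) ℂ) :=
  Measure.haarMeasure ⊤

/-! ### Complete unitary ergodicity -/

/-- The vectorized channel `V* ⊗ V` of a matrix `V`, where `V*` is the entrywise conjugate. -/
noncomputable def channel {d : ℕ} (V : Matrix (Fin d) (Fin d) ℂ) :
    Matrix (Fin d × Fin d) (Fin d × Fin d) ℂ :=
  V.map star ⊗ₖ V

/-- The projective unitary group `PU(d) = {V* ⊗ V : V ∈ U(d)}`. -/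
def projectiveUnitaryGroup (d : ℕ) : Set (Matrix (Fin d × Fin d) (Fin d × Fin d) ℂ) :=
  {C | ∃ V ∈ Matrix.unitaryGroup (Fin d) ℂ, C = channel V}

/-- Complete unitary ergodicity: the temporal ensemble `{U(t)* ⊗ U(t)}_{t ≥ 0}`, that is, the weak
limit of `T⁻¹ ∫₀ᵀ δ_{U(t)* ⊗ U(t)} dt` as `T → ∞`, exists and equals in distribution the ensemble
`{V* ⊗ V}` with `V` Haar random in `U(d)`. -/
def CompleteUnitaryErgodicity {d : ℕ} (U : ℝ → Matrix (Fin d) (Fin d) ℂ) : Prop :=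
  ∀ f : Matrix (Fin d × Fin d) (Fin d × Fin d) ℂ → ℝ,
    ContinuousOn f (projectiveUnitaryGroup d) →
    Tendsto (fun T : ℝ => T⁻¹ * ∫ t in (0 : ℝ)..T, f (channel (U t))) atTop
      (𝓝 (∫ V, f (channel (V : Matrix (Fin d) (Fin d) ℂ)) ∂(haarUnitary d)))

/-! The obstruction is a dimension count. In an eigenbasis `W` of `Q`, the factor `e^{-iQt}` is `W`
times a diagonal of `d` phases times `star W`. Hence, while `ωt` stays in a small closed ball inside
one smooth piece of `P`, the propagator `U(t)` lies in the image of a smooth map of `m + d` real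
parameters. Multiplication by a global phase only rotates the `d` phases, so passing to channels
costs no further parameter. Since `m < d(d-1)` means `m + d < d²`, the dimension of `U(d)`, the
unitaries whose channel lies in the resulting compact set `C` form a Haar-null set
(`haarUnitary_channel_phasePropagator_eq_zero`).

On the other hand, Weyl equidistribution makes the winding visit that ball for a positive fraction
`c` of the time (`exists_average_pos_near`). Continuous functions equal to `1` on `C` and tending to
`0` off it then have limiting time averages at least `c` but Haar averages tending to `0`, which
contradicts ergodicity. A single piece of `P` suffices, and resonances between `Q` and `ω` do not
matter because only the marginal distribution of `ωt` is used. -/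

/-! ### Equidistribution of linear windings -/

/-- The winding `t ↦ α t mod 1` on the unit torus. -/
noncomputable def unitWinding {m : ℕ} (α : Fin m → ℝ) (t : ℝ) : UnitAddTorus (Fin m) :=
  fun j => ((α j * t : ℝ) : UnitAddCircle)

lemma volume_real_univ_unitAddTorus (m : ℕ) :
    (volume : Measure (UnitAddTorus (Fin m))).real Set.univ = 1 := by
  simp [Measure.real, volume_pi, Measure.pi_univ]

lemma continuous_unitWinding {m : ℕ} (α : Fin m → ℝ) : Continuous (unitWinding α) :=
  continuous_pi fun j => (AddCircle.continuous_mk' 1).comp (by fun_prop)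

lemma mFourier_unitWinding {m : ℕ} (α : Fin m → ℝ) (n : Fin m → ℤ) (t : ℝ) :
    UnitAddTorus.mFourier n (unitWinding α t) =
      Complex.exp ((2 * Real.pi * (∑ j, (n j : ℝ) * α j : ℝ) * Complex.I) * t) := by
  simp only [UnitAddTorus.mFourier, unitWinding, ContinuousMap.coe_mk, fourier_coe_apply,
    ← Complex.exp_sum]
  congr 1
  push_cast
  rw [Finset.mul_sum, Finset.sum_mul, Finset.sum_mul]
  refine Finset.sum_congr rfl fun j _ => ?_
  ring

lemma mFourier_add_apply {m : ℕ} (n : Fin m → ℤ) (x y : UnitAddTorus (Fin m)) :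
    UnitAddTorus.mFourier n (x + y) = UnitAddTorus.mFourier n x * UnitAddTorus.mFourier n y := by
  simp only [UnitAddTorus.mFourier, ContinuousMap.coe_mk, Pi.add_apply, ← Finset.prod_mul_distrib]
  refine Finset.prod_congr rfl fun j _ => ?_
  simp [fourier_apply, AddCircle.toCircle_add, smul_add]

/-- The winding reaches, at time `1 / (2s)`, a point where the character equals `-1`. Translation by
this point preserves the integral and also changes its sign. -/
lemma integral_mFourier_eq_zero {m : ℕ} {α : Fin m → ℝ} {n : Fin m → ℤ}
    (hn : ∑ j, (n j : ℝ) * α j ≠ 0) : ∫ x, UnitAddTorus.mFourier n x = 0 := by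
  set s : ℝ := ∑ j, (n j : ℝ) * α j
  set a := unitWinding α (1 / (2 * s))
  have ha : UnitAddTorus.mFourier n a = -1 := by
    rw [mFourier_unitWinding, ← Complex.exp_pi_mul_I]
    congr 1
    have : (s : ℂ) ≠ 0 := by exact_mod_cast hn
    change 2 * (Real.pi : ℂ) * (s : ℂ) * Complex.I * _ = _
    push_cast
    field_simp
  have h := integral_add_right_eq_self (μ := (volume : Measure (UnitAddTorus (Fin m))))
    (fun x => UnitAddTorus.mFourier n x) a
  simp only [mFourier_add_apply, ha, integral_neg, mul_neg_one] at h
  linear_combination (-1 / 2 : ℂ) * h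

lemma tendsto_average_mFourier {m : ℕ} {α : Fin m → ℝ}
    (hα : ∀ n : Fin m → ℤ, ∑ j, (n j : ℝ) * α j = 0 → n = 0) (n : Fin m → ℤ) :
    Tendsto (fun T : ℝ => T⁻¹ • ∫ t in (0 : ℝ)..T, UnitAddTorus.mFourier n (unitWinding α t))
      atTop (𝓝 (∫ x, UnitAddTorus.mFourier n x)) := by
  by_cases hn : n = 0
  · subst hn
    simp only [UnitAddTorus.mFourier_zero, ContinuousMap.one_apply, intervalIntegral.integral_const,
      integral_const, volume_real_univ_unitAddTorus, sub_zero, one_smul]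
    refine tendsto_const_nhds.congr' ?_
    filter_upwards [eventually_gt_atTop 0] with T hT
    rw [smul_smul, inv_mul_cancel₀ hT.ne', one_smul]
  · have hs : ∑ j, (n j : ℝ) * α j ≠ 0 := fun h => hn (hα n h)
    rw [integral_mFourier_eq_zero hs]
    set s : ℝ := ∑ j, (n j : ℝ) * α j
    have hc : 2 * (Real.pi : ℂ) * (s : ℂ) * Complex.I ≠ 0 := by
      have : (s : ℂ) ≠ 0 := by exact_mod_cast hs
      simp [this, Real.pi_ne_zero]
    simp only [mFourier_unitWinding]
    change Tendsto (fun T : ℝ => T⁻¹ • ∫ t in (0 : ℝ)..T,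
      Complex.exp (2 * (Real.pi : ℂ) * (s : ℂ) * Complex.I * t)) atTop (𝓝 0)
    simp only [integral_exp_mul_complex hc]
    -- The exponential has nonzero frequency, so its integral over `[0, T]` stays bounded while the
    -- factor `T⁻¹` tends to zero.
    refine NormedField.tendsto_zero_smul_of_tendsto_zero_of_bounded
      (tendsto_inv_atTop_zero (𝕜 := ℝ)) ?_
    refine isBoundedUnder_of ⟨2 / ‖2 * (Real.pi : ℂ) * (s : ℂ) * Complex.I‖, fun T => ?_⟩
    simp only [Function.comp, norm_div]
    gcongr
    refine (norm_sub_le _ _).trans ?_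
    have h1 : ∀ r : ℝ, ‖Complex.exp (2 * (Real.pi : ℂ) * (s : ℂ) * Complex.I * r)‖ = 1 := by
      intro r
      rw [Complex.norm_exp]
      simp
    rw [h1, h1]
    norm_num

/-- Weyl's equidistribution theorem for linear windings of the unit torus. -/
lemma tendsto_average_unitWinding {m : ℕ} {α : Fin m → ℝ}
    (hα : ∀ n : Fin m → ℤ, ∑ j, (n j : ℝ) * α j = 0 → n = 0) (g : C(UnitAddTorus (Fin m), ℂ)) :
    Tendsto (fun T : ℝ => T⁻¹ • ∫ t in (0 : ℝ)..T, g (unitWinding α t)) atTop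
      (𝓝 (∫ x, g x)) := by
  have hint : ∀ (h : C(UnitAddTorus (Fin m), ℂ)) (T : ℝ),
      IntervalIntegrable (fun t => h (unitWinding α t)) volume 0 T := fun h T =>
    (h.continuous.comp (continuous_unitWinding α)).intervalIntegrable _ _
  have hint' : ∀ h : C(UnitAddTorus (Fin m), ℂ), Integrable (fun x => h x) volume := fun h =>
    h.continuous.integrable_of_hasCompactSupport (HasCompactSupport.of_compactSpace _)
  have hspan : ∀ h ∈ Submodule.span ℂ (Set.range (UnitAddTorus.mFourier (d := Fin m))),
      Tendsto (fun T : ℝ => T⁻¹ • ∫ t in (0 : ℝ)..T, h (unitWinding α t)) atTop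
      (𝓝 (∫ x, h x)) := by
    intro h hh
    induction hh using Submodule.span_induction with
    | mem x hx => obtain ⟨n, rfl⟩ := hx; exact tendsto_average_mFourier hα n
    | zero => simp
    | add x y _ _ hx hy =>
      simp only [ContinuousMap.add_apply]
      rw [integral_add (hint' x) (hint' y)]
      refine (hx.add hy).congr fun T => ?_
      rw [intervalIntegral.integral_add (hint x T) (hint y T), smul_add]
    | smul c x _ hx =>
      simp only [ContinuousMap.smul_apply]
      rw [integral_smul]
      refine (hx.const_smul c).congr fun T => ?_
      rw [intervalIntegral.integral_smul, smul_comm]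
  -- Trigonometric polynomials are uniformly dense, and both kinds of average are contractions for
  -- the sup norm.
  have hg : g ∈ closure (Submodule.span ℂ (Set.range (UnitAddTorus.mFourier (d := Fin m))) :
      Set C(UnitAddTorus (Fin m), ℂ)) := by
    rw [← Submodule.topologicalClosure_coe, UnitAddTorus.span_mFourier_closure_eq_top]
    trivial
  rw [Metric.tendsto_atTop]
  intro ε hε
  obtain ⟨h, hh, hgh⟩ := Metric.mem_closure_iff.mp hg (ε / 3) (by positivity)
  obtain ⟨N, hN⟩ := Metric.tendsto_atTop.mp (hspan h hh) (ε / 3) (by positivity)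
  have hpt : ∀ x, ‖g x - h x‖ ≤ ε / 3 := fun x => by
    rw [← dist_eq_norm]
    exact (ContinuousMap.dist_apply_le_dist x).trans hgh.le
  refine ⟨max N 1, fun T hT => ?_⟩
  have hT1 : 0 < T := zero_lt_one.trans_le ((le_max_right _ _).trans hT)
  have h1 : dist (T⁻¹ • ∫ t in (0 : ℝ)..T, g (unitWinding α t))
      (T⁻¹ • ∫ t in (0 : ℝ)..T, h (unitWinding α t)) ≤ ε / 3 := by
    rw [dist_eq_norm, ← smul_sub, ← intervalIntegral.integral_sub (hint g T) (hint h T), norm_smul]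
    have := intervalIntegral.norm_integral_le_of_norm_le_const (a := 0) (b := T)
      (f := fun t => g (unitWinding α t) - h (unitWinding α t)) fun t _ => hpt _
    rw [sub_zero, abs_of_pos hT1] at this
    calc _ ≤ ‖T⁻¹‖ * (ε / 3 * T) := by gcongr
      _ = ε / 3 := by
        rw [Real.norm_of_nonneg (by positivity)]
        field_simp
  have h2 : dist (∫ x, h x) (∫ x, g x) ≤ ε / 3 := by
    rw [dist_comm, dist_eq_norm, ← integral_sub (hint' g) (hint' h)]
    refine (norm_integral_le_of_norm_le_const (Eventually.of_forall hpt)).trans ?_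
    rw [volume_real_univ_unitAddTorus, mul_one]
  have h3 := hN T ((le_max_left _ _).trans hT)
  have h4 := dist_triangle4 (T⁻¹ • ∫ t in (0 : ℝ)..T, g (unitWinding α t))
      (T⁻¹ • ∫ t in (0 : ℝ)..T, h (unitWinding α t)) (∫ x, h x) (∫ x, g x)
  linarith

/-- A winding with rationally independent frequencies spends a positive fraction of time near each
point of the torus. -/
lemma exists_average_pos_near {m : ℕ} {ω : Fin m → ℝ} (hω : RationallyIndependent ω)
    (x₀ : Fin m → ℝ) {r : ℝ} (hr : 0 < r) :
    ∃ (φ : ℝ → ℝ) (c : ℝ), 0 < c ∧ Continuous φ ∧ (∀ t, φ t ≤ 1) ∧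
      (∀ t, 0 < φ t → ∃ x ∈ Metric.closedBall x₀ r, winding ω t = toTorus x) ∧
      Tendsto (fun T : ℝ => T⁻¹ * ∫ t in (0 : ℝ)..T, φ t) atTop (𝓝 c) := by
  have hpi := Real.pi_pos
  set α : Fin m → ℝ := fun j => ω j / (2 * Real.pi) with hαdef
  have hα : ∀ n : Fin m → ℤ, ∑ j, (n j : ℝ) * α j = 0 → n = 0 := by
    intro n hn
    apply hω n
    have : ∑ j, (n j : ℝ) * ω j = 2 * Real.pi * ∑ j, (n j : ℝ) * α j := by
      rw [Finset.mul_sum]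
      refine Finset.sum_congr rfl fun j _ => ?_
      simp only [hαdef]
      field_simp
    rw [this, hn, mul_zero]
  set y₀ : UnitAddTorus (Fin m) := fun j => ((x₀ j / (2 * Real.pi) : ℝ) : UnitAddCircle)
  -- The bound `1` keeps the tent function `g` at most `1`; the other bound converts the radius `r`
  -- to a unit period.
  set δ : ℝ := min 1 (r / (2 * Real.pi))
  have hδ : 0 < δ := lt_min one_pos (by positivity)
  set g : UnitAddTorus (Fin m) → ℝ := fun y => max 0 (δ - dist y y₀) with hgdef
  have hgc : Continuous g := by fun_prop
  have hgpos : 0 < ∫ y, g y := by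
    refine hgc.integral_pos_of_hasCompactSupport_nonneg_nonzero
      (HasCompactSupport.of_compactSpace _) (fun y => le_max_left _ _) (x := y₀) ?_
    simp [hgdef, hδ.ne', hδ.le]
  refine ⟨fun t => g (unitWinding α t), ∫ y, g y, hgpos, hgc.comp (continuous_unitWinding α),
    fun t => ?_, fun t ht => ?_, ?_⟩
  · refine max_le zero_le_one ?_
    have := dist_nonneg (x := unitWinding α t) (y := y₀)
    have : δ ≤ 1 := min_le_left _ _
    linarith
  · have hd : dist (unitWinding α t) y₀ < δ := by
      by_contra hcon
      have : g (unitWinding α t) = 0 := max_eq_left (by linarith)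
      exact ht.ne' this
    have hj : ∀ j, |α j * t - x₀ j / (2 * Real.pi)
        - round (α j * t - x₀ j / (2 * Real.pi))| < δ := by
      intro j
      rw [← UnitAddCircle.norm_eq]
      refine lt_of_le_of_lt ?_ hd
      refine le_trans (le_of_eq ?_) (dist_le_pi_dist _ _ j)
      rw [dist_eq_norm]
      rfl
    -- Removing the nearest whole number of periods gives the lift of `ωt` closest to `x₀`.
    refine ⟨fun j => ω j * t - round (α j * t - x₀ j / (2 * Real.pi)) * (2 * Real.pi), ?_, ?_⟩
    · rw [Metric.mem_closedBall, dist_pi_le_iff hr.le]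
      intro j
      rw [Real.dist_eq]
      have h1 : ω j * t - round (α j * t - x₀ j / (2 * Real.pi)) * (2 * Real.pi) - x₀ j
          = (2 * Real.pi) * (α j * t - x₀ j / (2 * Real.pi)
            - round (α j * t - x₀ j / (2 * Real.pi))) := by
        have h2 : ω j = 2 * Real.pi * α j := by simp only [hαdef]; field_simp
        have h3 : x₀ j = 2 * Real.pi * (x₀ j / (2 * Real.pi)) := by field_simp
        linear_combination t * h2 - h3
      rw [h1, abs_mul, abs_of_pos (by positivity)]
      calc _ ≤ 2 * Real.pi * (r / (2 * Real.pi)) := by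
            gcongr
            exact (hj j).le.trans (min_le_right _ _)
        _ = r := by field_simp
    · funext j
      simp only [winding, toTorus]
      rw [AddCircle.coe_sub, eq_comm, sub_eq_self]
      rw [← zsmul_eq_mul, AddCircle.coe_zsmul, AddCircle.coe_period, smul_zero]
  · have h := tendsto_average_unitWinding hα ⟨fun y => (g y : ℂ), by fun_prop⟩
    simp only [ContinuousMap.coe_mk, intervalIntegral.integral_ofReal, integral_complex_ofReal] at h
    have h' := (Complex.continuous_re.tendsto _).comp h
    simpa [Function.comp_def] using h'

/-! ### The Cayley transform -/

/-- The Hermitian matrix with real coordinates `x`. -/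
noncomputable def hermitianOfReal {d : ℕ} (x : Fin d × Fin d → ℝ) : Matrix (Fin d) (Fin d) ℂ :=
  Matrix.of fun a b => ((x (a, b) + x (b, a) : ℝ) : ℂ) + ((x (a, b) - x (b, a) : ℝ) : ℂ) * Complex.I

lemma hermitianOfReal_isHermitian {d : ℕ} (x : Fin d × Fin d → ℝ) :
    (hermitianOfReal x).IsHermitian := by
  ext a b
  apply Complex.ext <;> simp [hermitianOfReal]
  ring

/-- The real part is symmetric in the two indices and the imaginary part antisymmetric, so their sum
isolates one coordinate. -/
lemma coord_hermitianOfReal {d : ℕ} (x : Fin d × Fin d → ℝ) (p : Fin d × Fin d) :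
    ((hermitianOfReal x p.1 p.2).re + (hermitianOfReal x p.1 p.2).im) / 2 = x p := by
  simp [hermitianOfReal]

/-- The Cayley transform `(1 + iA) (1 - iA)⁻¹`. -/
noncomputable def cayley {d : ℕ} (A : Matrix (Fin d) (Fin d) ℂ) : Matrix (Fin d) (Fin d) ℂ :=
  (1 + Complex.I • A) * (1 - Complex.I • A)⁻¹

lemma conjTranspose_one_sub_I_smul {d : ℕ} {A : Matrix (Fin d) (Fin d) ℂ} (hA : A.IsHermitian) :
    (1 - Complex.I • A).conjTranspose = 1 + Complex.I • A := by
  simp [Matrix.conjTranspose_sub, Matrix.conjTranspose_smul, hA.eq]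

-- The product `(1 - iA)(1 + iA) = 1 + A*A` is positive definite, hence invertible.
open scoped ComplexOrder in
lemma isUnit_det_one_sub_I_smul {d : ℕ} {A : Matrix (Fin d) (Fin d) ℂ} (hA : A.IsHermitian) :
    IsUnit (1 - Complex.I • A).det := by
  have h : (1 - Complex.I • A) * (1 + Complex.I • A) = 1 + A.conjTranspose * A := by
    rw [hA.eq]
    simp only [sub_mul, mul_add, one_mul, mul_one, Matrix.smul_mul, Matrix.mul_smul, smul_smul,
      Complex.I_mul_I, neg_smul, one_smul]
    abel
  have hpos : (1 + A.conjTranspose * A).PosDef :=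
    Matrix.PosDef.one.add_posSemidef (Matrix.posSemidef_conjTranspose_mul_self A)
  have hu := (Matrix.isUnit_iff_isUnit_det _).mp hpos.isUnit
  rw [← h, Matrix.det_mul] at hu
  exact isUnit_of_mul_isUnit_left hu

lemma cayley_mem_unitaryGroup {d : ℕ} {A : Matrix (Fin d) (Fin d) ℂ} (hA : A.IsHermitian) :
    cayley A ∈ Matrix.unitaryGroup (Fin d) ℂ := by
  rw [Matrix.mem_unitaryGroup_iff, Matrix.star_eq_conjTranspose, cayley,
    Matrix.conjTranspose_mul, Matrix.conjTranspose_nonsing_inv, conjTranspose_one_sub_I_smul hA,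
    ← conjTranspose_one_sub_I_smul hA, Matrix.conjTranspose_conjTranspose]
  have hM := isUnit_det_one_sub_I_smul hA
  have hcomm : (1 - Complex.I • A) * (1 - Complex.I • A).conjTranspose
      = (1 - Complex.I • A).conjTranspose * (1 - Complex.I • A) := by
    rw [conjTranspose_one_sub_I_smul hA]
    simp only [sub_mul, mul_add, add_mul, mul_sub, one_mul, mul_one]
    abel
  generalize 1 - Complex.I • A = M at *
  have hM' : IsUnit M.conjTranspose.det := by
    rw [Matrix.det_conjTranspose]
    exact hM.star
  calc M.conjTranspose * M⁻¹ * (M.conjTranspose⁻¹ * M)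
      = M.conjTranspose * (M.conjTranspose * M)⁻¹ * M := by
        rw [Matrix.mul_inv_rev]; noncomm_ring
    _ = 1 := by
        rw [← hcomm, Matrix.mul_inv_rev, ← mul_assoc, Matrix.mul_nonsing_inv _ hM', one_mul,
          Matrix.nonsing_inv_mul _ hM]

lemma cayley_add_one {d : ℕ} {A : Matrix (Fin d) (Fin d) ℂ} (hA : A.IsHermitian) :
    cayley A + 1 = (2 : ℂ) • (1 - Complex.I • A)⁻¹ := by
  have hM := isUnit_det_one_sub_I_smul hA
  nth_rewrite 1 [← Matrix.mul_nonsing_inv _ hM]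
  rw [cayley, ← add_mul, two_smul]
  noncomm_ring

lemma det_cayley_add_one_ne_zero {d : ℕ} {A : Matrix (Fin d) (Fin d) ℂ} (hA : A.IsHermitian) :
    (cayley A + 1).det ≠ 0 := by
  have hM := isUnit_det_one_sub_I_smul hA
  rw [cayley_add_one hA, Matrix.det_smul]
  exact mul_ne_zero (pow_ne_zero _ two_ne_zero)
    (Matrix.isUnit_nonsing_inv_det _ hM).ne_zero

/-- This formula makes sense, and is smooth, at every matrix without eigenvalue `-1`, so it can be
composed with an arbitrary smooth family. -/
lemma inverse_cayley {d : ℕ} {A : Matrix (Fin d) (Fin d) ℂ} (hA : A.IsHermitian) :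
    (-Complex.I) • ((cayley A + 1)⁻¹ * (cayley A - 1)) = A := by
  have hM := isUnit_det_one_sub_I_smul hA
  have h1 : (cayley A + 1) * A = (-Complex.I) • (cayley A - 1) := by
    have h2 : cayley A * (1 - Complex.I • A) = 1 + Complex.I • A := by
      rw [cayley, mul_assoc, Matrix.nonsing_inv_mul _ hM, mul_one]
    have h3 : cayley A - 1 = Complex.I • ((cayley A + 1) * A) := by
      rw [mul_sub, mul_one, Matrix.mul_smul, sub_eq_iff_eq_add] at h2
      rw [add_mul, one_mul, smul_add, sub_eq_iff_eq_add]
      exact h2.trans (by abel)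
    rw [h3, smul_smul]
    simp
  rw [← Matrix.mul_smul, ← h1, ← mul_assoc,
    Matrix.nonsing_inv_mul _ (det_cayley_add_one_ne_zero hA).isUnit, one_mul]

lemma continuous_cayley_hermitianOfReal {d : ℕ} :
    Continuous fun x : Fin d × Fin d → ℝ => cayley (hermitianOfReal x) := by
  have hh : Continuous fun x : Fin d × Fin d → ℝ => hermitianOfReal x :=
    continuous_matrix fun a b => by simp only [hermitianOfReal, Matrix.of_apply]; fun_prop
  have hI := hh.const_smul Complex.I
  have hM := continuous_const (y := (1 : Matrix (Fin d) (Fin d) ℂ)) |>.sub hI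
  have hinv : Continuous fun x : Fin d × Fin d → ℝ => (1 - Complex.I • hermitianOfReal x)⁻¹ := by
    simp only [Matrix.inv_def, Ring.inverse_eq_inv']
    refine Continuous.smul (Continuous.inv₀ hM.matrix_det fun x => ?_) hM.matrix_adjugate
    exact (isUnit_det_one_sub_I_smul (hermitianOfReal_isHermitian x)).ne_zero
  exact (continuous_const.add hI).matrix_mul hinv

/-! ### Smooth images of low dimension are null -/

section Smooth

variable {E : Type*} [NormedAddCommGroup E] [NormedSpace ℝ E] {d : ℕ} {n : WithTop ℕ∞} {p : E}

lemma contDiffAt_matrix_det {M : E → Matrix (Fin d) (Fin d) ℂ}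
    (hM : ∀ a b, ContDiffAt ℝ n (fun p => M p a b) p) : ContDiffAt ℝ n (fun p => (M p).det) p := by
  simp only [Matrix.det_apply']
  exact ContDiffAt.sum fun σ _ => contDiffAt_const.mul (contDiffAt_prod fun i _ => hM _ _)

lemma contDiffAt_matrix_mul {M N : E → Matrix (Fin d) (Fin d) ℂ}
    (hM : ∀ a b, ContDiffAt ℝ n (fun p => M p a b) p)
    (hN : ∀ a b, ContDiffAt ℝ n (fun p => N p a b) p) (a b : Fin d) :
    ContDiffAt ℝ n (fun p => (M p * N p) a b) p := by
  simp only [Matrix.mul_apply]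
  exact ContDiffAt.sum fun c _ => (hM _ _).mul (hN _ _)

lemma contDiffAt_matrix_inv {M : E → Matrix (Fin d) (Fin d) ℂ}
    (hM : ∀ a b, ContDiffAt ℝ n (fun p => M p a b) p) (hdet : (M p).det ≠ 0) (a b : Fin d) :
    ContDiffAt ℝ n (fun p => (M p)⁻¹ a b) p := by
  simp only [Matrix.inv_def, Ring.inverse_eq_inv', Matrix.smul_apply, smul_eq_mul,
    Matrix.adjugate_apply]
  refine ((contDiffAt_matrix_det hM).inv hdet).mul (contDiffAt_matrix_det fun i j => ?_)
  by_cases hi : i = b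
  · subst hi
    simp only [Matrix.updateRow_self]
    exact contDiffAt_const
  · simp only [Matrix.updateRow_ne hi]
    exact hM i j

end Smooth

/-- A `C¹` map is locally Lipschitz, so it does not raise Hausdorff dimension, and Lebesgue measure
is Hausdorff measure of dimension `card ι`. No measurability of `s` is needed. -/
lemma volume_image_eq_zero_of_contDiffAt {E ι : Type*} [NormedAddCommGroup E] [NormedSpace ℝ E]
    [FiniteDimensional ℝ E] [Fintype ι] {G : E → ι → ℝ} {s : Set E}
    (hG : ∀ p ∈ s, ContDiffAt ℝ 1 G p) (hdim : Module.finrank ℝ E < Fintype.card ι) :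
    volume (G '' s) = 0 := by
  have h1 : dimH (G '' s) ≤ dimH s := by
    refine dimH_image_le_of_locally_lipschitzOn fun p hp => ?_
    obtain ⟨K, t, ht, hL⟩ := (hG p hp).exists_lipschitzOnWith
    exact ⟨K, t, mem_nhdsWithin_of_mem_nhds ht, hL⟩
  have h2 : dimH s ≤ Module.finrank ℝ E := by
    rw [← Real.dimH_univ_eq_finrank E]
    exact dimH_mono (Set.subset_univ _)
  have h3 : dimH (G '' s) < ((Fintype.card ι : NNReal) : ENNReal) := by
    refine (h1.trans h2).trans_lt ?_
    exact_mod_cast hdim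
  have h4 := hausdorffMeasure_of_dimH_lt h3
  rw [← hausdorffMeasure_pi_real]
  exact_mod_cast h4

lemma volume_cayley_preimage_image_eq_zero {E : Type*} [NormedAddCommGroup E] [NormedSpace ℝ E]
    [FiniteDimensional ℝ E] {d : ℕ} {V : E → Matrix (Fin d) (Fin d) ℂ} {s : Set E}
    (hV : ∀ p ∈ s, ∀ a b, ContDiffAt ℝ 1 (fun p => V p a b) p)
    (hdim : Module.finrank ℝ E < d * d) :
    volume {x | cayley (hermitianOfReal x) ∈ V '' s} = 0 := by
  set A : E → Matrix (Fin d) (Fin d) ℂ := fun p => (-Complex.I) • ((V p + 1)⁻¹ * (V p - 1))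
  -- Parameters with `det (V p + 1) = 0` can be dropped, since a Cayley transform never has
  -- eigenvalue `-1`. On the others the inverse Cayley transform is smooth.
  refine measure_mono_null (t := (fun p (q : Fin d × Fin d) =>
    ((A p q.1 q.2).re + (A p q.1 q.2).im) / 2) '' {p ∈ s | (V p + 1).det ≠ 0}) ?_ ?_
  · rintro x ⟨p, hp, hpx⟩
    have hx := hermitianOfReal_isHermitian x
    refine ⟨p, ⟨hp, ?_⟩, ?_⟩
    · rw [hpx]
      exact det_cayley_add_one_ne_zero hx
    · have hA : A p = hermitianOfReal x := by
        simp only [A, hpx]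
        exact inverse_cayley hx
      funext q
      simp only [hA]
      exact coord_hermitianOfReal x q
  · refine volume_image_eq_zero_of_contDiffAt (fun p hp => ?_) (by simpa using hdim)
    rw [contDiffAt_pi]
    intro q
    have h1 : ∀ a b, ContDiffAt ℝ 1 (fun p => (V p + 1) a b) p := fun a b =>
      (hV p hp.1 a b).add contDiffAt_const
    have h2 : ∀ a b, ContDiffAt ℝ 1 (fun p => (V p - 1) a b) p := fun a b =>
      (hV p hp.1 a b).sub contDiffAt_const
    have h3 : ContDiffAt ℝ 1 (fun p => A p q.1 q.2) p :=
      contDiffAt_const.mul (contDiffAt_matrix_mul (contDiffAt_matrix_inv h1 hp.2) h2 q.1 q.2)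
    have h4 := Complex.reCLM.contDiff.contDiffAt.comp p h3
    have h5 := Complex.imCLM.contDiff.contDiffAt.comp p h3
    exact (h4.add h5).div_const 2

/-! ### Haar measure of smooth images in the unitary group -/

instance instSecondCountableTopologyUnitaryGroup (d : ℕ) :
    SecondCountableTopology (Matrix.unitaryGroup (Fin d) ℂ) :=
  haveI : SecondCountableTopology (Matrix (Fin d) (Fin d) ℂ) :=
    inferInstanceAs (SecondCountableTopology (Fin d → Fin d → ℂ))
  TopologicalSpace.Subtype.secondCountableTopology _

instance instIsHaarMeasureHaarUnitary (d : ℕ) : (haarUnitary d).IsHaarMeasure :=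
  inferInstanceAs (Measure.haarMeasure ⊤).IsHaarMeasure

/-- Fubini replaces any formula for Haar measure in Cayley coordinates. For each fixed `h`, the `x`
with `c x * h ∈ S` are Lebesgue-null, being covered by the translated family `V p * h⁻¹`. Hence for
almost every `x` the `h` with `c x * h ∈ S` are Haar-null, and one such `x` suffices by left
invariance. -/
lemma haarUnitary_eq_zero_of_subset_image {E : Type*} [NormedAddCommGroup E] [NormedSpace ℝ E]
    [FiniteDimensional ℝ E] {d : ℕ} {V : E → Matrix (Fin d) (Fin d) ℂ} {s : Set E}
    (hV : ∀ p ∈ s, ∀ a b, ContDiffAt ℝ 1 (fun p => V p a b) p)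
    (hdim : Module.finrank ℝ E < d * d) {S : Set (Matrix.unitaryGroup (Fin d) ℂ)}
    (hS : IsClosed S) (hSV : ∀ g ∈ S, (g : Matrix (Fin d) (Fin d) ℂ) ∈ V '' s) :
    haarUnitary d S = 0 := by
  set c : (Fin d × Fin d → ℝ) → Matrix.unitaryGroup (Fin d) ℂ := fun x =>
    ⟨cayley (hermitianOfReal x), cayley_mem_unitaryGroup (hermitianOfReal_isHermitian x)⟩
  have hc : Continuous c := continuous_cayley_hermitianOfReal.subtype_mk _
  have hmeas : MeasurableSet {q : (Fin d × Fin d → ℝ) × Matrix.unitaryGroup (Fin d) ℂ |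
      c q.1 * q.2 ∈ S} :=
    (hS.preimage ((hc.comp continuous_fst).mul continuous_snd)).measurableSet
  have hnull : (volume.prod (haarUnitary d)) {q : (Fin d × Fin d → ℝ) ×
      Matrix.unitaryGroup (Fin d) ℂ | c q.1 * q.2 ∈ S} = 0 := by
    rw [← Measure.prod_swap, Measure.map_apply measurable_swap hmeas,
      Measure.measure_prod_null (measurable_swap hmeas)]
    refine Eventually.of_forall fun h => ?_
    refine measure_mono_null (t := {x | cayley (hermitianOfReal x) ∈
      (fun p => V p * ((h⁻¹ : Matrix.unitaryGroup (Fin d) ℂ) : Matrix (Fin d) (Fin d) ℂ)) '' s})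
      ?_ (volume_cayley_preimage_image_eq_zero
        (fun p hp => contDiffAt_matrix_mul (hV p hp) fun _ _ => contDiffAt_const) hdim)
    intro x hx
    obtain ⟨p, hp, hpx⟩ := hSV _ hx
    refine ⟨p, hp, ?_⟩
    have h1 : c x = (c x * h) * h⁻¹ := by group
    calc V p * ((h⁻¹ : Matrix.unitaryGroup (Fin d) ℂ) : Matrix (Fin d) (Fin d) ℂ)
        = (((c x * h) * h⁻¹ : Matrix.unitaryGroup (Fin d) ℂ) : Matrix (Fin d) (Fin d) ℂ) := by
          rw [hpx]; rfl
      _ = cayley (hermitianOfReal x) := by rw [← h1]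
  have hae := Measure.measure_ae_null_of_prod_null hnull
  obtain ⟨x, hx⟩ := hae.exists
  have h2 := measure_preimage_mul (haarUnitary d) (c x) S
  rw [← h2]
  exact hx

/-! ### Channels and projective equality -/

lemma continuous_channel {d : ℕ} :
    Continuous (channel : Matrix (Fin d) (Fin d) ℂ → Matrix (Fin d × Fin d) (Fin d × Fin d) ℂ) :=
  continuous_matrix fun p q =>
    ((continuous_id.matrix_elem p.1 q.1).star).mul (continuous_id.matrix_elem p.2 q.2)

/-- The channel lists all products of a conjugated entry with an entry. Fixing one nonzero entry as
reference recovers the matrix up to the phase of that entry. -/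
lemma exists_smul_eq_of_channel_eq {d : ℕ} {V V' : Matrix (Fin d) (Fin d) ℂ} (hV' : V' ≠ 0)
    (h : channel V = channel V') : ∃ z : ℂ, ‖z‖ = 1 ∧ V = z • V' := by
  obtain ⟨a, b, hab⟩ : ∃ a b, V' a b ≠ 0 := by
    by_contra! hcon
    exact hV' (Matrix.ext hcon)
  have he : ∀ i j k l, star (V i j) * V k l = star (V' i j) * V' k l := fun i j k l =>
    congrFun (congrFun h (i, k)) (j, l)
  have hnorm : ‖V a b‖ = ‖V' a b‖ := by
    have h1 := congrArg norm (he a b a b)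
    rw [norm_mul, norm_mul, norm_star, norm_star] at h1
    exact (mul_self_inj (norm_nonneg _) (norm_nonneg _)).mp h1
  have hne : star (V a b) ≠ 0 := by
    rw [star_ne_zero, ← norm_ne_zero_iff, hnorm]
    exact norm_ne_zero_iff.mpr hab
  refine ⟨star (V' a b) / star (V a b), ?_, ?_⟩
  · rw [norm_div, norm_star, norm_star, hnorm, div_self (norm_ne_zero_iff.mpr hab)]
  · ext i j
    rw [Matrix.smul_apply, smul_eq_mul, div_mul_eq_mul_div, ← he a b i j,
      mul_div_cancel_left₀ _ hne]

/-! ### Approximation of closed sets -/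

lemma exists_seq_continuous_tendsto_zero_compl {X : Type*} [TopologicalSpace X]
    [TopologicalSpace.PseudoMetrizableSpace X] {C : Set X} (hC : IsClosed C) (hne : C.Nonempty) :
    ∃ f : ℕ → X → ℝ, (∀ n, Continuous (f n)) ∧ (∀ n x, 0 ≤ f n x) ∧ (∀ n x, f n x ≤ 1) ∧
      (∀ n, ∀ x ∈ C, f n x = 1) ∧ ∀ x ∉ C, Tendsto (fun n => f n x) atTop (𝓝 0) := by
  let _ := TopologicalSpace.pseudoMetrizableSpacePseudoMetric X
  refine ⟨fun n x => max 0 (1 - n * Metric.infDist x C), fun n => ?_, fun n x => le_max_left _ _,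
    fun n x => ?_, fun n x hx => ?_, fun x hx => ?_⟩
  · have := Metric.continuous_infDist_pt C
    fun_prop
  · have : 0 ≤ n * Metric.infDist x C := mul_nonneg n.cast_nonneg Metric.infDist_nonneg
    exact max_le zero_le_one (by linarith)
  · simp [Metric.infDist_zero_of_mem hx]
  · have hpos : 0 < Metric.infDist x C := (hC.notMem_iff_infDist_pos hne).mp hx
    refine tendsto_const_nhds.congr' ?_
    have hlim : Tendsto (fun n : ℕ => (n : ℝ) * Metric.infDist x C) atTop atTop :=
      tendsto_natCast_atTop_atTop.atTop_mul_const hpos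
    filter_upwards [hlim.eventually_ge_atTop 1] with n hn
    rw [max_eq_left (by linarith)]

/-! ### Exponentials of Hermitian matrices -/

/-- One `W` and one list `q` serve all times, so time enters only through `d` phases. -/
lemma exp_neg_I_mul_smul_of_isHermitian {d : ℕ} {Q : Matrix (Fin d) (Fin d) ℂ}
    (hQ : Q.IsHermitian) : ∃ W ∈ Matrix.unitaryGroup (Fin d) ℂ, ∃ q : Fin d → ℝ, ∀ t : ℝ,
      NormedSpace.exp ((-(Complex.I * (t : ℂ))) • Q) =
        W * Matrix.diagonal (fun j => Complex.exp ((-(q j * t) : ℝ) * Complex.I)) * star W := by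
  refine ⟨hQ.eigenvectorUnitary.1, hQ.eigenvectorUnitary.2, hQ.eigenvalues, fun t => ?_⟩
  set W : Matrix (Fin d) (Fin d) ℂ := hQ.eigenvectorUnitary.1
  have hW : W * star W = 1 := Matrix.mem_unitaryGroup_iff.mp hQ.eigenvectorUnitary.2
  have hW' : star W * W = 1 := Matrix.mem_unitaryGroup_iff'.mp hQ.eigenvectorUnitary.2
  have hinv : W⁻¹ = star W := Matrix.inv_eq_right_inv hW
  have hunit : IsUnit W := ⟨⟨W, star W, hW, hW'⟩, rfl⟩
  have hs : (-(Complex.I * (t : ℂ))) • Q = W * Matrix.diagonal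
      (fun j => ((-(hQ.eigenvalues j * t) : ℝ) * Complex.I)) * W⁻¹ := by
    conv_lhs => rw [hQ.spectral_theorem]
    rw [Unitary.conjStarAlgAut_apply, hinv, ← Matrix.smul_mul, ← Matrix.mul_smul,
      ← Matrix.diagonal_smul]
    congr 3
    funext j
    simp only [Pi.smul_apply, Function.comp, smul_eq_mul]
    push_cast
    simp only [Complex.coe_algebraMap]
    ring
  rw [hs, Matrix.exp_conj _ _ hunit, Matrix.exp_diagonal, hinv]
  congr 3
  funext j
  rw [Pi.coe_exp, ← Complex.exp_eq_exp_ℂ]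

/-! ### The range of the propagator over a smooth piece -/

/-- The propagators with micromotion `P`, eigenbasis `W`, torus coordinates `p.1` and dynamical
phase factors `p.2`. -/
noncomputable def phasePropagator {m d : ℕ} (P : Torus m → Matrix (Fin d) (Fin d) ℂ)
    (W : Matrix (Fin d) (Fin d) ℂ) (p : (Fin m → ℝ) × (Fin d → ℂ)) : Matrix (Fin d) (Fin d) ℂ :=
  P (toTorus p.1) * (W * Matrix.diagonal p.2 * star W)

lemma smul_phasePropagator {m d : ℕ} (P : Torus m → Matrix (Fin d) (Fin d) ℂ)
    (W : Matrix (Fin d) (Fin d) ℂ) (x : Fin m → ℝ) (z : Fin d → ℂ) (w : ℂ) :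
    w • phasePropagator P W (x, z) = phasePropagator P W (x, w • z) := by
  simp only [phasePropagator, Matrix.diagonal_smul, Matrix.mul_smul, Matrix.smul_mul]

lemma diagonal_mem_unitaryGroup {d : ℕ} {z : Fin d → ℂ} (hz : ∀ j, ‖z j‖ = 1) :
    Matrix.diagonal z ∈ Matrix.unitaryGroup (Fin d) ℂ := by
  rw [Matrix.mem_unitaryGroup_iff, Matrix.star_eq_conjTranspose, Matrix.diagonal_conjTranspose,
    Matrix.diagonal_mul_diagonal, ← Matrix.diagonal_one]
  congr 1
  funext j
  simp [Complex.mul_conj, Complex.normSq_eq_norm_sq, hz]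

lemma phasePropagator_mem_unitaryGroup {m d : ℕ} {P : Torus m → Matrix (Fin d) (Fin d) ℂ}
    {W : Matrix (Fin d) (Fin d) ℂ} (hP : ∀ θ, P θ ∈ Matrix.unitaryGroup (Fin d) ℂ)
    (hW : W ∈ Matrix.unitaryGroup (Fin d) ℂ) {p : (Fin m → ℝ) × (Fin d → ℂ)}
    (hp : ∀ j, ‖p.2 j‖ = 1) : phasePropagator P W p ∈ Matrix.unitaryGroup (Fin d) ℂ :=
  mul_mem (hP _) (mul_mem (mul_mem hW (diagonal_mem_unitaryGroup hp)) (Unitary.star_mem hW))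

lemma continuous_toTorus {m : ℕ} : Continuous (toTorus : (Fin m → ℝ) → Torus m) :=
  continuous_pi fun j => (AddCircle.continuous_mk' _).comp (continuous_apply j)

lemma surjective_toTorus {m : ℕ} : Function.Surjective (toTorus : (Fin m → ℝ) → Torus m) :=
  fun θ => ⟨fun j => (QuotientAddGroup.mk_surjective (θ j)).choose,
    funext fun j => (QuotientAddGroup.mk_surjective (θ j)).choose_spec⟩

lemma continuousOn_phasePropagator {m d : ℕ} {P : Torus m → Matrix (Fin d) (Fin d) ℂ}
    (W : Matrix (Fin d) (Fin d) ℂ) {s : Set (Fin m → ℝ)}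
    (hP : ∀ a b, ContinuousOn (fun x : Fin m → ℝ => P (toTorus x) a b) s) :
    ContinuousOn (phasePropagator P W) (s ×ˢ Set.univ) := by
  have h1 : ContinuousOn (fun p : (Fin m → ℝ) × (Fin d → ℂ) => P (toTorus p.1))
      (s ×ˢ Set.univ) :=
    continuousOn_pi.mpr fun a => continuousOn_pi.mpr fun b =>
      (hP a b).comp continuousOn_fst fun p hp => hp.1
  have h2 : Continuous fun p : (Fin m → ℝ) × (Fin d → ℂ) =>
      W * Matrix.diagonal p.2 * star W :=
    (continuous_const.matrix_mul continuous_snd.matrix_diagonal).matrix_mul continuous_const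
  exact h1.mul h2.continuousOn

lemma haarUnitary_channel_phasePropagator_eq_zero {m d : ℕ}
    {P : Torus m → Matrix (Fin d) (Fin d) ℂ} {W : Matrix (Fin d) (Fin d) ℂ}
    (hP : ∀ θ, P θ ∈ Matrix.unitaryGroup (Fin d) ℂ) (hW : W ∈ Matrix.unitaryGroup (Fin d) ℂ)
    {s K : Set (Fin m → ℝ)} (hs : IsOpen s)
    (hPs : ∀ a b, ContDiffOn ℝ 1 (fun x : Fin m → ℝ => P (toTorus x) a b) s)
    (hKs : K ⊆ s) (hd : 0 < d) (hdim : m + d < d * d)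
    (hclosed : IsClosed (channel '' (phasePropagator P W ''
      (K ×ˢ Set.univ.pi fun _ => Metric.sphere (0 : ℂ) 1)))) :
    haarUnitary d {V | channel (V : Matrix (Fin d) (Fin d) ℂ) ∈ channel '' (phasePropagator P W ''
      (K ×ˢ Set.univ.pi fun _ => Metric.sphere (0 : ℂ) 1))} = 0 := by
  have : Nonempty (Fin d) := ⟨⟨0, hd⟩⟩
  refine haarUnitary_eq_zero_of_subset_image (E := (Fin m → ℝ) × (Fin d → ℝ))
    (V := fun p => phasePropagator P W (p.1, fun j => Complex.exp (p.2 j * Complex.I)))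
    (s := s ×ˢ Set.univ) ?_ (by simpa using hdim)
    (hclosed.preimage (continuous_channel.comp continuous_subtype_val)) ?_
  · intro p hp
    have h1 : ∀ a b, ContDiffAt ℝ 1
        (fun p : (Fin m → ℝ) × (Fin d → ℝ) => P (toTorus p.1) a b) p := fun a b =>
      ((hPs a b).contDiffAt (hs.mem_nhds hp.1)).comp p contDiffAt_fst
    have h2 : ∀ a b, ContDiffAt ℝ 1 (fun p : (Fin m → ℝ) × (Fin d → ℝ) =>
        Matrix.diagonal (fun j => Complex.exp (p.2 j * Complex.I)) a b) p := by
      intro a b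
      by_cases hab : a = b
      · subst hab
        simp only [Matrix.diagonal_apply_eq]
        have h3 : ContDiff ℝ 1 fun p : (Fin m → ℝ) × (Fin d → ℝ) => ((p.2 a : ℝ) : ℂ) :=
          Complex.ofRealCLM.contDiff.comp
            ((contDiff_apply ℝ ℝ a).comp contDiff_snd)
        exact (h3.mul contDiff_const).cexp.contDiffAt
      · simp only [Matrix.diagonal_apply_ne _ hab]
        exact contDiffAt_const
    exact contDiffAt_matrix_mul h1 (contDiffAt_matrix_mul
      (contDiffAt_matrix_mul (fun _ _ => contDiffAt_const) h2) fun _ _ => contDiffAt_const)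
  · rintro V ⟨_, ⟨⟨x, z⟩, ⟨hx, hz⟩, rfl⟩, hV⟩
    have hz1 : ∀ j, ‖z j‖ = 1 := fun j => mem_sphere_zero_iff_norm.mp (hz j trivial)
    have hne : phasePropagator P W (x, z) ≠ 0 := by
      intro h0
      have h1 := Matrix.mem_unitaryGroup_iff.mp (phasePropagator_mem_unitaryGroup hP hW
        (p := (x, z)) hz1)
      rw [h0, zero_mul] at h1
      exact zero_ne_one h1
    obtain ⟨w, hw, hVw⟩ := exists_smul_eq_of_channel_eq hne hV.symm
    -- The global phase `w` left undetermined by the channel is absorbed into the dynamical phases.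
    refine ⟨(x, fun j => Complex.arg (w * z j)), ⟨hKs hx, trivial⟩, ?_⟩
    rw [hVw, smul_phasePropagator]
    simp only
    congr 2
    funext j
    have h1 := Complex.norm_mul_exp_arg_mul_I (w * z j)
    rw [norm_mul, hw, hz1, mul_one, Complex.ofReal_one, one_mul] at h1
    exact h1

/-! ### Time averages against Haar averages. -/

theorem theorem3 (d m : ℕ) (ω : Fin m → ℝ) (H U : ℝ → Matrix (Fin d) (Fin d) ℂ)
    (hH : IsQuasiperiodicHamiltonian ω H) (hU : IsEvolutionOperator H U)
    (hQE : HasQuasienergyEigenbasis ω U) (hm : m < d * (d - 1)) :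
    ¬ CompleteUnitaryErgodicity U := by
  intro herg
  obtain ⟨P, Q, hF⟩ := hQE
  obtain ⟨O, hO, -, hvol, hsmooth⟩ := hF.piecewiseSmooth
  have hd : 0 < d := Nat.pos_of_ne_zero fun h => by simp [h] at hm
  have hdim : m + d < d * d := by
    obtain ⟨e, rfl⟩ : ∃ e, d = e + 1 := ⟨d - 1, by omega⟩
    rw [Nat.add_sub_cancel] at hm
    linarith
  obtain ⟨k, θ₀, hθ₀⟩ : ∃ k, (O k).Nonempty := by
    by_contra! hcon
    rw [Set.iUnion_eq_empty.mpr hcon, Set.compl_empty] at hvol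
    exact isOpen_univ.measure_ne_zero _ Set.univ_nonempty hvol
  obtain ⟨x₀, rfl⟩ := surjective_toTorus θ₀
  set s : Set (Fin m → ℝ) := toTorus ⁻¹' O k
  have hs : IsOpen s := (hO k).preimage continuous_toTorus
  -- A closed ball inside the open piece gives a compact parameter set `K` on which `P` is
  -- continuous, hence a closed `C`.
  obtain ⟨r, hr, hrs⟩ := Metric.nhds_basis_closedBall.mem_iff.mp (hs.mem_nhds hθ₀)
  obtain ⟨W, hW, q, hexp⟩ := exp_neg_I_mul_smul_of_isHermitian hF.hermitian
  have hPs : ∀ a b, ContDiffOn ℝ 1 (fun x : Fin m → ℝ => P (toTorus x) a b) s := fun a b =>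
    (hsmooth k a b).of_le (by exact_mod_cast le_top)
  set K := Metric.closedBall x₀ r ×ˢ Set.univ.pi fun _ : Fin d => Metric.sphere (0 : ℂ) 1
  set C := channel '' (phasePropagator P W '' K) with hCdef
  have hKc : IsCompact K :=
    (isCompact_closedBall _ _).prod (isCompact_univ_pi fun _ => isCompact_sphere _ _)
  have hcont : ContinuousOn (phasePropagator P W) K :=
    (continuousOn_phasePropagator W fun a b => (hPs a b).continuousOn).mono
      (Set.prod_mono hrs (Set.subset_univ _))
  have hClosed : IsClosed C := ((hKc.image_of_continuousOn hcont).image continuous_channel).isClosed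
  have hnull := haarUnitary_channel_phasePropagator_eq_zero hF.unitary hW hs hPs hrs hd hdim hClosed
  have hCne : C.Nonempty := by
    refine Set.Nonempty.image _ (Set.Nonempty.image _ ⟨(x₀, fun _ => 1), ?_, ?_⟩)
    · exact Metric.mem_closedBall_self hr.le
    · intro j _
      simp
  obtain ⟨φ, c, hc, hφ, hφ1, hφC, hφlim⟩ := exists_average_pos_near hH.1 x₀ hr
  have : TopologicalSpace.PseudoMetrizableSpace (Matrix (Fin d × Fin d) (Fin d × Fin d) ℂ) :=
    inferInstanceAs (TopologicalSpace.PseudoMetrizableSpace (Fin d × Fin d → Fin d × Fin d → ℂ))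
  obtain ⟨f, hf, hf0, hf1, hfC, hflim⟩ := exists_seq_continuous_tendsto_zero_compl hClosed hCne
  -- Where `φ t > 0` the winding is in the ball, so the channel of `U t` lies in `C` and `f n`
  -- equals `1` there.
  have hle : ∀ n, ∀ t : ℝ, 0 ≤ t → φ t ≤ f n (channel (U t)) := by
    intro n t ht
    rcases le_or_gt (φ t) 0 with h | h
    · exact h.trans (hf0 _ _)
    · obtain ⟨x, hx, hwx⟩ := hφC t h
      rw [hfC]
      · exact hφ1 t
      · refine ⟨_, ⟨(x, fun j => Complex.exp ((-(q j * t) : ℝ) * Complex.I)), ⟨hx, ?_⟩, rfl⟩, ?_⟩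
        · intro j _
          rw [mem_sphere_zero_iff_norm]
          exact Complex.norm_exp_ofReal_mul_I _
        · rw [hF.decomposition t ht, hexp, hwx]
          rfl
  -- Ergodicity turns the lower bound on time averages into one on Haar averages, uniform in `n`.
  have hbound : ∀ n, c ≤ ∫ V, f n (channel (V : Matrix (Fin d) (Fin d) ℂ)) ∂(haarUnitary d) := by
    intro n
    refine le_of_tendsto_of_tendsto hφlim (herg (f n) (hf n).continuousOn) ?_
    filter_upwards [eventually_gt_atTop 0] with T hT
    refine mul_le_mul_of_nonneg_left ?_ (inv_nonneg.mpr hT.le)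
    refine intervalIntegral.integral_mono_on hT.le (hφ.intervalIntegrable _ _) ?_
      fun t ht => hle n t ht.1
    refine ContinuousOn.intervalIntegrable_of_Icc hT.le ?_
    exact ((hf n).comp continuous_channel).comp_continuousOn
      (hU.continuousOn.mono Set.Icc_subset_Ici_self)
  have hlim : Tendsto (fun n => ∫ V, f n (channel (V : Matrix (Fin d) (Fin d) ℂ))
      ∂(haarUnitary d)) atTop (𝓝 (∫ _, (0 : ℝ) ∂(haarUnitary d))) := by
    refine tendsto_integral_of_dominated_convergence (fun _ => 1) (fun n => ?_)
      (integrable_const _) (fun n => ?_) ?_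
    · exact ((hf n).comp
        (continuous_channel.comp continuous_subtype_val)).aestronglyMeasurable
    · refine Eventually.of_forall fun V => ?_
      rw [Real.norm_of_nonneg (hf0 _ _)]
      exact hf1 _ _
    · filter_upwards [measure_eq_zero_iff_ae_notMem.mp hnull] with V hV
      exact hflim _ hV
  rw [integral_zero] at hlim
  exact hc.not_ge (ge_of_tendsto' hlim hbound)
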